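/- Let $G$ be a (finite-dimensional, real) Lie group with Lie algebra $\mathfrak g=T_1G$, acting smoothly from the left on a smooth finite-dimensional manifold $M$, and let $\lambda_*(v,u)=\frac{d}{dt}\big|_{t=0}\exp(tv)\cdot u\in T_uM$ for $v\in\mathfrak g$, $u\in M$, be the infinitesimal generator. Let $\Omega^0(M,\mathfrak g)$ be the real vector space of smooth maps $M\to\mathfrak g$; each $x\in\Omega^0(M,\mathfrak g)$ generates the vector field $\lambda_*(x)(u)=\lambda_*(x(u),u)$ on $M$. For $x,y\in\Omega^0(M,\mathfrak g)$ define, pointwise at $u\in M$, $$[x,y](u)=[x(u),y(u)]_{\mathfrak g},\qquad x\rhd y=\lambda_*(x)(y)\quad\text{(the Lie derivative of $y$ along $\lambda_*(x)$)},$$ where $[\cdot,\cdot]_{\mathfrak g}$ is the Lie bracket on $\mathfrak g$ obtained by identifying $\mathfrak g$ with the right-invariant vector fields on $G$ (with the bracket of vector fields $[\![X,Y]\!](\phi)=X(Y(\phi))-Y(X(\phi))$). Then both operations map $\Omega^0(M,\mathfrak g)\times\Omega^0(M,\mathfrak g)$ bilinearly into $\Omega^0(M,\mathfrak g)$, and $\{\Omega^0(M,\mathfrak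 g),[\cdot,\cdot],\rhd\}$ is a post-Lie algebra, that is, $[\cdot,\cdot]$ is a Lie bracket and, for all $x,y,z$, $$x\rhd[y,z]=[x\rhd y,z]+[y,x\rhd z],\qquad [x,y]\rhd z=a_\rhd(x,y,z)-a_\rhd(y,x,z),$$ where $a_\rhd(x,y,z)=x\rhd(y\rhd z)-(x\rhd y)\rhd z$. Equivalently, if $[\cdot,\cdot]_{\mathfrak g}$ is instead the bracket defined by left-invariant vector fields, and $[\cdot,\cdot]$ is the corresponding pointwise bracket, then $\{\Omega^0(M,\mathfrak g),-[\cdot,\cdot],\rhd\}$ is a post-Lie algebra. -/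

import Mathlib

open scoped Manifold ContDiff

noncomputable section

/-- A post-Lie algebra: a `k`-module `A` with two `k`-bilinear products, the bracket `br` and the
product `tri`, such that `br` is a Lie bracket, every `tri x` is a derivation of the bracket, and
`[x, y] ▷ z = a(x, y, z) - a(y, x, z)`, where `a(x, y, z) = x ▷ (y ▷ z) - (x ▷ y) ▷ z`. -/
structure IsPostLieAlgebra {k A : Type*} [Field k] [AddCommGroup A] [Module k A]
    (br tri : A →ₗ[k] A →ₗ[k] A) : Prop where
  lie_self : ∀ x, br x x = 0
  jacobi : ∀ x y z, br (br x y) z + br (br y z) x + br (br z x) y = 0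
  tri_br : ∀ x y z, tri x (br y z) = br (tri x y) z + br y (tri x z)
  br_tri : ∀ x y z, tri (br x y) z =
    (tri x (tri y z) - tri (tri x y) z) - (tri y (tri x z) - tri (tri y x) z)

section LieGroup

variable {E : Type*} [NormedAddCommGroup E] [NormedSpace ℝ E]
  {H : Type*} [TopologicalSpace H] (I : ModelWithCorners ℝ E H)
  {G : Type*} [TopologicalSpace G] [ChartedSpace H G]

/-- The tangent space at `p` is, as a topological vector space, the model space `E` (through the
preferred chart at `p`): this is the identity map. It is used to speak of smooth and differentiable
Lie algebra valued functions, and to carry a tangent vector from a base point to an equal one. -/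
def tangentModel (p : G) : TangentSpace I p ≃L[ℝ] E := ContinuousLinearEquiv.refl ℝ E

variable [Group G]

open Classical in
/-- The exponential map of a Lie group: `exp v = γ 1`, where `γ` is the (unique, globally defined)
integral curve through `1` of the left-invariant vector field with value `v` at `1`. -/
def lieExp (v : GroupLieAlgebra I G) : G :=
  if h : ∃ γ : ℝ → G, γ 0 = 1 ∧
      IsMIntegralCurve (I := I) γ (mulInvariantVectorField (I := I) (G := G) v)
  then h.choose 1 else 1

/-- The right-invariant vector field with value `v` at the identity: at `g` it is the image of `v`
under the derivative at `1` of right translation by `g`. -/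
def rightInvariantVectorField (v : GroupLieAlgebra I G) (g : G) : TangentSpace I g :=
  (tangentModel I g).symm (tangentModel I (1 * g) (mfderiv I I (fun h : G => h * g) 1 v))

/-- The bracket on the Lie algebra obtained by identifying it with the right-invariant vector
fields. (Mathlib's bracket `⁅v, w⁆` on `GroupLieAlgebra I G` uses the left-invariant ones.) -/
def rightLieBracket (v w : GroupLieAlgebra I G) : GroupLieAlgebra I G :=
  VectorField.mlieBracket I (rightInvariantVectorField I v) (rightInvariantVectorField I w) (1 : G)

variable {E' : Type*} [NormedAddCommGroup E'] [NormedSpace ℝ E']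
  {H' : Type*} [TopologicalSpace H'] (J : ModelWithCorners ℝ E' H')
  {M : Type*} [TopologicalSpace M] [ChartedSpace H' M]

/-- The infinitesimal generator `λ_*(v, u) = d/dt|_{t=0} exp(t v) • u`, a tangent vector at
`exp(0) • u = u`. -/
def infinitesimalGenerator [MulAction G M] (v : GroupLieAlgebra I G) (u : M) : TangentSpace J u :=
  (tangentModel J u).symm (tangentModel J (lieExp I ((0 : ℝ) • v) • u)
    (mfderiv 𝓘(ℝ, ℝ) J (fun t : ℝ => lieExp I (t • v) • u) 0
      ((NormedSpace.fromTangentSpace (𝕜 := ℝ) (0 : ℝ)).symm 1)))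

/-- The vector field `λ_*(x)` on `M` generated by a Lie algebra valued function `x`. -/
def generatedField [MulAction G M] (x : M → GroupLieAlgebra I G) (u : M) : TangentSpace J u :=
  infinitesimalGenerator I J (x u) u

/-- The Lie derivative of the Lie algebra valued function `y` along the vector field `X`:
`u ↦ dy_u (X u)`. -/
def lieDerivAlong (X : (u : M) → TangentSpace J u) (y : M → GroupLieAlgebra I G) (u : M) :
    GroupLieAlgebra I G :=
  (tangentModel I (1 : G)).symm (mvfderiv J (fun p : M => tangentModel I (1 : G) (y p)) u (X u))

variable (G M) in
/-- `Ω⁰(M, 𝔤)`: the real vector space of smooth functions from `M` to the Lie algebra of `G`. -/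
def smoothLieValued : Submodule ℝ (M → GroupLieAlgebra I G) where
  carrier := {x | ContMDiff J 𝓘(ℝ, E) ∞ (fun p : M => tangentModel I (1 : G) (x p))}
  zero_mem' := by
    simpa using (contMDiff_const : ContMDiff J 𝓘(ℝ, E) ∞ fun _ : M => (0 : E))
  add_mem' := fun {x y} hx hy => by
    have h : ContMDiff J 𝓘(ℝ, E) ∞
        (fun p : M => tangentModel I (1 : G) (x p) + tangentModel I (1 : G) (y p)) :=
      ContMDiff.add hx hy
    simpa using h
  smul_mem' := fun c x hx => by
    have h : ContMDiff J 𝓘(ℝ, E) ∞ (fun p : M => c • tangentModel I (1 : G) (x p)) :=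
      ContMDiff.smul (contMDiff_const : ContMDiff J 𝓘(ℝ, ℝ) ∞ fun _ : M => c) hx
    simpa using h

end LieGroup

end

open Set Filter Topology

/-! ### One-parameter subgroups and the exponential map -/

section Exponential

variable {E : Type*} [NormedAddCommGroup E] [NormedSpace ℝ E]
  {H : Type*} [TopologicalSpace H] {I : ModelWithCorners ℝ E H}
  {G : Type*} [TopologicalSpace G] [ChartedSpace H G] [Group G]

/-! Write `Dz(u) v` for `actionDeriv I G z u v`, the derivative at `1` of the orbit function `g ↦ z
(g • u)` in the direction `v`. Since `t ↦ exp (t v)` passes through `1` with velocity `v`, the chain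
rule gives `x ▷ y = Dy(x)` (`mvfderiv_infinitesimalGenerator`), and the exponential map disappears
from the problem.

The identity `z (g • (h • u)) = z ((g * h) • u)` shows that along an orbit `p ↦ Dz(p) w` is the
derivative of the orbit function along the right-invariant field of `w` (`actionDeriv_smul_apply`).
Evaluating the commutator of two such fields at `1` therefore gives the second axiom for constant
`x` and `y` (`actionDeriv_rightLieBracket`). For variable `x`, `y` the product rule adds a term
`Dz(Dy(x)) = (x ▷ y) ▷ z`, which is exactly what the associator subtracts
(`actionDeriv_associator`).

The derivation axiom is the Leibniz rule for a fixed bilinear map. Inversion exchanges left- and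
right-invariant fields and has derivative `-1` at `1`, so the two brackets are opposite
(`rightLieBracket_eq_neg_bracket`). This gives the Jacobi identity and the left-invariant version.
-/

theorem mulInvariantVectorField_one (v : GroupLieAlgebra I G) :
    mulInvariantVectorField v (1 : G) = v := by
  have h : (fun x : G => 1 * x) = id := by ext; simp
  simp only [mulInvariantVectorField]
  rw [h, mfderiv_id]
  rfl

variable [LieGroup I ∞ G]

theorem mdifferentiableAt_const_mul (g h : G) : MDifferentiableAt I I (g * ·) h :=
  (contMDiff_mul_left (I := I) (n := ∞)).contMDiffAt.mdifferentiableAt (by simp)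

theorem mdifferentiableAt_mul_const (g h : G) : MDifferentiableAt I I (· * g) h :=
  (contMDiff_mul_right (I := I) (n := ∞)).contMDiffAt.mdifferentiableAt (by simp)

theorem mfderiv_const_mul_mulInvariantVectorField (v : GroupLieAlgebra I G) (g h : G) :
    mfderiv I I (g * ·) h (mulInvariantVectorField v h) = mulInvariantVectorField v (g * h) := by
  have D : (fun x : G => g * h * x) = (g * ·) ∘ (h * ·) := by
    ext x; simp [mul_assoc]
  simp only [mulInvariantVectorField]
  rw [D, mfderiv_comp_of_eq (I' := I) (y := h) (mdifferentiableAt_const_mul g h)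
    (mdifferentiableAt_const_mul h 1) (mul_one h)]
  exact DFunLike.congr_fun (F := E →L[ℝ] E) (mfderiv_congr_point (mul_one h).symm) _

theorem contMDiff_one_mulInvariantVectorField (v : GroupLieAlgebra I G) :
    ContMDiff I I.tangent 1
      (fun g : G => (⟨g, mulInvariantVectorField v g⟩ : TangentBundle I G)) := by
  have : LieGroup I (minSmoothness ℝ 3) G :=
    LieGroup.of_le (n := ∞) (by rw [minSmoothness_of_isRCLikeNormedField]; exact WithTop.coe_le_coe.2 le_top)
  refine (contMDiff_mulInvariantVectorField v).of_le ?_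
  rw [minSmoothness_of_isRCLikeNormedField]
  exact one_le_two

variable [T2Space G] [BoundarylessManifold I G] [CompleteSpace E]

/-- Left translates of a local integral curve through `1` are integral curves through every point,
all with the same lifetime `ε`. A uniform lifetime forces completeness. -/
theorem exists_isMIntegralCurve_mulInvariantVectorField (v : GroupLieAlgebra I G) :
    ∃ γ : ℝ → G, γ 0 = 1 ∧ IsMIntegralCurve (I := I) γ (mulInvariantVectorField v) := by
  have : IsManifold I 1 G := IsManifold.of_le (n := ∞) (by simp)
  obtain ⟨γ, h0, hγ⟩ := exists_isMIntegralCurveAt_of_contMDiffAt_boundaryless (t₀ := 0)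
    (contMDiff_one_mulInvariantVectorField (I := I) (G := G) v).contMDiffAt (x₀ := 1)
  obtain ⟨ε, hε, hγ⟩ := isMIntegralCurveAt_iff'.1 hγ
  refine exists_isMIntegralCurve_of_isMIntegralCurveOn
    (contMDiff_one_mulInvariantVectorField v) hε (fun g => ⟨fun t => g * γ t, by simp [h0], ?_⟩) 1
  intro t ht
  have ht' : t ∈ Metric.ball (0 : ℝ) ε := by simpa [Real.ball_eq_Ioo] using ht
  have h1 := (hγ t ht').hasMFDerivAt (Metric.isOpen_ball.mem_nhds ht')
  have h2 := ((mdifferentiableAt_const_mul (I := I) g (γ t)).hasMFDerivAt.comp t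
    h1).hasMFDerivWithinAt (s := Ioo (-ε) ε)
  refine h2.congr_mfderiv ?_
  ext
  change mfderiv I I (g * ·) (γ t) ((1 : ℝ) • mulInvariantVectorField v (γ t)) =
    (1 : ℝ) • mulInvariantVectorField v (g * γ t)
  rw [one_smul, one_smul]
  exact mfderiv_const_mul_mulInvariantVectorField v g (γ t)

/-- The curve chosen inside `lieExp` for `t • v` is, by uniqueness, the time-rescaled curve `s ↦ γ
(s * t)`, evaluated at `s = 1`. -/
theorem lieExp_smul {v : GroupLieAlgebra I G} {γ : ℝ → G} (h0 : γ 0 = 1)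
    (hγ : IsMIntegralCurve (I := I) γ (mulInvariantVectorField v)) (t : ℝ) :
    lieExp I (t • v) = γ t := by
  have : IsManifold I 1 G := IsManifold.of_le (n := ∞) (by simp)
  have h := exists_isMIntegralCurve_mulInvariantVectorField (t • v)
  rw [lieExp, dif_pos h]
  have h1 : IsMIntegralCurve (I := I) (γ ∘ (· * t)) (mulInvariantVectorField (t • v)) := by
    rw [mulInvariantVectorField_smul]
    exact hγ.comp_mul t
  have h2 := isMIntegralCurve_Ioo_eq_of_contMDiff_boundaryless (t₀ := 0)
    (contMDiff_one_mulInvariantVectorField (t • v)) h.choose_spec.2 h1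
    (by simp [h.choose_spec.1, h0])
  rw [h2]
  simp

end Exponential

/-! ### The Lie bracket of vector fields as a commutator of derivations -/

section LieBracketOfFunctions

open VectorField

variable {E : Type*} [NormedAddCommGroup E] [NormedSpace ℝ E]
  {H : Type*} [TopologicalSpace H] {I : ModelWithCorners ℝ E H}
  {M : Type*} [TopologicalSpace M] [ChartedSpace H M]
  {F : Type*} [NormedAddCommGroup F] [NormedSpace ℝ F]
  {f : M → F} {V W : (p : M) → TangentSpace I p} {x : M}

/-- The chain rule in a chart. It is needed on a neighbourhood, not only at the point, because both
sides are differentiated once more. -/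
theorem eventually_mvfderiv_extChartAt_symm [IsManifold I 2 M] [CompleteSpace E]
    (hf : ContMDiffAt I 𝓘(ℝ, F) 2 f x) (hx : I.IsInteriorPoint x)
    (W : (p : M) → TangentSpace I p) :
    ∀ᶠ q in 𝓝 (extChartAt I x x),
      mvfderiv I f ((extChartAt I x).symm q) (W ((extChartAt I x).symm q)) =
        fderiv ℝ (f ∘ (extChartAt I x).symm) q
          (mpullbackWithin 𝓘(ℝ, E) I (extChartAt I x).symm W (range I) q) := by
  have : IsManifold I 1 M := IsManifold.of_le (n := 2) one_le_two
  have hR := range_mem_nhds_isInteriorPoint hx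
  have hT : (extChartAt I x).target ∈ 𝓝 (extChartAt I x x) := by
    have h := extChartAt_target_mem_nhdsWithin (I := I) x
    rwa [nhdsWithin_eq_nhds.2 hR] at h
  have hfd : ∀ᶠ q in 𝓝 (extChartAt I x x),
      MDifferentiableAt I 𝓘(ℝ, F) f ((extChartAt I x).symm q) := by
    have h1 : ∀ᶠ p in 𝓝 x, MDifferentiableAt I 𝓘(ℝ, F) f p :=
      ((contMDiffAt_iff_contMDiffAt_nhds (by simp)).1 hf).mono
        fun p hp => hp.mdifferentiableAt two_ne_zero
    have h2 := continuousAt_extChartAt_symm (I := I) x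
    rw [ContinuousAt, extChartAt_to_inv] at h2
    exact h2.eventually h1
  filter_upwards [eventually_mem_nhds_iff.2 hR, hT, hfd] with q hqR hqT hqf
  have hA := isInvertible_mfderivWithin_extChartAt_symm (I := I) hqT
  have h1 := mfderiv_comp_mfderivWithin (s := range I) (f := (extChartAt I x).symm) q hqf
    (mdifferentiableWithinAt_extChartAt_symm hqT)
    (I.uniqueMDiffOn _ (mem_of_mem_nhds hqR))
  rw [mfderivWithin_eq_fderivWithin, fderivWithin_of_mem_nhds hqR] at h1
  have h2 := DFunLike.congr_fun h1
    (mpullbackWithin 𝓘(ℝ, E) I (extChartAt I x).symm W (range I) q)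
  refine Eq.trans ?_ h2.symm
  refine congrArg (mfderiv I 𝓘(ℝ, F) f ((extChartAt I x).symm q)) ?_
  rw [mpullbackWithin_apply]
  exact (hA.self_apply_inverse _).symm

theorem mpullbackWithin_extChartAt_symm_self [IsManifold I 1 M]
    (W : (p : M) → TangentSpace I p) (x : M) :
    @Eq E (mpullbackWithin 𝓘(ℝ, E) I (extChartAt I x).symm W (range I) (extChartAt I x x))
      (W x) := by
  have h : ∀ z, z = x → @Eq E (W z) (W x) := by rintro z rfl; rfl
  refine Eq.trans ?_ (h _ (extChartAt_to_inv (I := I) x))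
  exact mfderivWithin_extChartAt_symm_inverse_apply (I := I) (M := M) (H := H) (x := x)
    (W ((extChartAt I x).symm (extChartAt I x x)))

theorem mlieBracket_eq_lieBracket_extChartAt [IsManifold I 1 M]
    (hx : I.IsInteriorPoint x) :
    @Eq E (mlieBracket I V W x) (lieBracket ℝ
      (mpullbackWithin 𝓘(ℝ, E) I (extChartAt I x).symm V (range I))
      (mpullbackWithin 𝓘(ℝ, E) I (extChartAt I x).symm W (range I)) (extChartAt I x x)) := by
  have hR := range_mem_nhds_isInteriorPoint hx
  have hid : ∀ A : E →L[ℝ] E, A = ContinuousLinearMap.id ℝ E → ∀ e, A.inverse e = e := by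
    rintro A rfl e
    rw [ContinuousLinearMap.inverse_id, ContinuousLinearMap.id_apply]
  rw [← mlieBracketWithin_univ, mlieBracketWithin_apply, preimage_univ, univ_inter]
  exact (hid _ mfderiv_extChartAt_self _).trans (lieBracketWithin_of_mem_nhds hR)

/-- In the chart this is the product rule for `q ↦ Df(q) (W q)`; the chart has derivative the
identity at its base point. -/
theorem mvfderiv_mvfderiv_apply [IsManifold I 2 M] [CompleteSpace E]
    (hf : ContMDiffAt I 𝓘(ℝ, F) 2 f x) (hx : I.IsInteriorPoint x)
    (hW : MDifferentiableAt I I.tangent (fun p => (⟨p, W p⟩ : TangentBundle I M)) x)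
    (u : TangentSpace I x) :
    mvfderiv I (fun p => mvfderiv I f p (W p)) x u =
      fderiv ℝ (fderiv ℝ (f ∘ (extChartAt I x).symm)) (extChartAt I x x) u (W x) +
      fderiv ℝ (f ∘ (extChartAt I x).symm) (extChartAt I x x)
        (fderiv ℝ (mpullbackWithin 𝓘(ℝ, E) I (extChartAt I x).symm W (range I))
          (extChartAt I x x) u) := by
  have : IsManifold I 1 M := IsManifold.of_le (n := 2) one_le_two
  have hR := range_mem_nhds_isInteriorPoint hx
  have hW' : DifferentiableAt ℝ
      (mpullbackWithin 𝓘(ℝ, E) I (extChartAt I x).symm W (range I)) (extChartAt I x x) := by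
    have h := (mdifferentiableWithinAt_univ.2
      hW).differentiableWithinAt_mpullbackWithin_vectorField
    rw [preimage_univ, univ_inter] at h
    exact h.differentiableAt hR
  have hf' : ContDiffAt ℝ 2 (f ∘ (extChartAt I x).symm) (extChartAt I x x) :=
    (contMDiffAt_iff.1 hf).2.contDiffAt hR
  have hdf : DifferentiableAt ℝ (fderiv ℝ (f ∘ (extChartAt I x).symm)) (extChartAt I x x) :=
    (hf'.fderiv_right (m := 1) le_rfl).differentiableAt one_ne_zero
  have hD := hdf.hasFDerivAt.clm_apply hW'.hasFDerivAt
  have hφ : HasMFDerivAt I 𝓘(ℝ, E) (extChartAt I x) x (ContinuousLinearMap.id ℝ E) :=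
    (mdifferentiableAt_extChartAt (mem_chart_source H x)).hasMFDerivAt.congr_mfderiv
      mfderiv_extChartAt_self
  have hc := hD.hasMFDerivAt.comp x hφ
  have he : (fun p => mvfderiv I f p (W p)) =ᶠ[𝓝 x] (fun q =>
      fderiv ℝ (f ∘ (extChartAt I x).symm) q
        (mpullbackWithin 𝓘(ℝ, E) I (extChartAt I x).symm W (range I) q)) ∘ extChartAt I x := by
    filter_upwards [(continuousAt_extChartAt (I := I) x).eventually
      (eventually_mvfderiv_extChartAt_symm hf hx W), extChartAt_source_mem_nhds (I := I) x]
      with p hp hps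
    rw [(extChartAt I x).left_inv hps] at hp
    exact hp
  have hm := (hc.congr_of_eventuallyEq he).mfderiv
  refine (DFunLike.congr_fun hm u).trans ?_
  have hx' := mpullbackWithin_extChartAt_symm_self W x
  refine (add_comm _ _).trans (congrArg₂ (· + ·) ?_ rfl)
  exact congrArg (fun e : E =>
    fderiv ℝ (fderiv ℝ (f ∘ (extChartAt I x).symm)) (extChartAt I x x) u e) hx'

/-- The second-derivative terms cancel by symmetry, and what remains is `Df` applied to the bracket
computed in the chart. At an interior point `range I` is a neighbourhood, so derivatives within it
are ordinary ones. -/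
theorem mvfderiv_mlieBracket [IsManifold I 2 M] [CompleteSpace E]
    (hf : ContMDiffAt I 𝓘(ℝ, F) 2 f x) (hx : I.IsInteriorPoint x)
    (hV : MDifferentiableAt I I.tangent (fun p => (⟨p, V p⟩ : TangentBundle I M)) x)
    (hW : MDifferentiableAt I I.tangent (fun p => (⟨p, W p⟩ : TangentBundle I M)) x) :
    mvfderiv I f x (mlieBracket I V W x) =
      mvfderiv I (fun p => mvfderiv I f p (W p)) x (V x) -
        mvfderiv I (fun p => mvfderiv I f p (V p)) x (W x) := by
  have : IsManifold I 1 M := IsManifold.of_le (n := 2) one_le_two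
  have hR := range_mem_nhds_isInteriorPoint hx
  have hf' : ContDiffAt ℝ 2 (f ∘ (extChartAt I x).symm) (extChartAt I x x) :=
    (contMDiffAt_iff.1 hf).2.contDiffAt hR
  have hsymm := hf'.isSymmSndFDerivAt (by simp) (V x) (W x)
  have hd : @Eq (E →L[ℝ] F) (mvfderiv I f x)
      (fderiv ℝ (f ∘ (extChartAt I x).symm) (extChartAt I x x)) := by
    refine (hf.mdifferentiableAt two_ne_zero).mvfderiv.trans ?_
    rw [fderivWithin_of_mem_nhds hR]
    rfl
  rw [mvfderiv_mvfderiv_apply hf hx hV, mvfderiv_mvfderiv_apply hf hx hW]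
  refine (DFunLike.congr_fun hd _).trans ?_
  refine (congrArg (fderiv ℝ (f ∘ (extChartAt I x).symm) (extChartAt I x x))
    (mlieBracket_eq_lieBracket_extChartAt hx)).trans ?_
  refine (map_sub (fderiv ℝ (f ∘ (extChartAt I x).symm) (extChartAt I x x)) _ _).trans ?_
  rw [hsymm, add_sub_add_left_eq_sub]
  refine congrArg₂ (· - ·) ?_ ?_
  · exact congrArg (fun e : E => fderiv ℝ (f ∘ (extChartAt I x).symm) (extChartAt I x x)
      (fderiv ℝ (mpullbackWithin 𝓘(ℝ, E) I (extChartAt I x).symm W (range I))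
        (extChartAt I x x) e)) (mpullbackWithin_extChartAt_symm_self V x)
  · exact congrArg (fun e : E => fderiv ℝ (f ∘ (extChartAt I x).symm) (extChartAt I x x)
      (fderiv ℝ (mpullbackWithin 𝓘(ℝ, E) I (extChartAt I x).symm V (range I))
        (extChartAt I x x) e)) (mpullbackWithin_extChartAt_symm_self W x)

end LieBracketOfFunctions

/-! ### Inversion and right-invariant vector fields -/

section RightInvariant

open VectorField

variable {E : Type*} [NormedAddCommGroup E] [NormedSpace ℝ E]
  {H : Type*} [TopologicalSpace H] {I : ModelWithCorners ℝ E H}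
  {G : Type*} [TopologicalSpace G] [ChartedSpace H G] [Group G] [LieGroup I ∞ G]

theorem mdifferentiableAt_inv (g : G) : MDifferentiableAt I I (fun x : G => x⁻¹) g :=
  (contMDiff_inv I ∞).contMDiffAt.mdifferentiableAt (by simp)

/-- Differentiate `x * x⁻¹ = 1` at `1`, where the derivative of multiplication is addition. -/
theorem mfderiv_inv_one (v : GroupLieAlgebra I G) :
    @Eq E (mfderiv I I (fun x : G => x⁻¹) 1 v) (-v) := by
  have hmul : MDifferentiableAt (I.prod I) I (fun p : G × G => p.1 * p.2) (1, 1) :=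
    (contMDiff_mul I ∞).contMDiffAt.mdifferentiableAt (by simp)
  have hpair : MDifferentiableAt I (I.prod I) (fun x : G => (x, x⁻¹)) 1 :=
    mdifferentiableAt_id.prodMk (mdifferentiableAt_inv 1)
  have hconst : (fun p : G × G => p.1 * p.2) ∘ (fun x : G => (x, x⁻¹)) = fun _ => (1 : G) := by
    ext x; simp
  have h0 := mfderiv_comp_apply_of_eq (g := fun p : G × G => p.1 * p.2)
    (f := fun x : G => (x, x⁻¹)) (x := 1) (y := (1, 1)) hmul hpair (by simp) v
  rw [hconst, mfderiv_const] at h0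
  have hp : @Eq (E × E) (mfderiv I (I.prod I) (fun x : G => (x, x⁻¹)) 1 v)
      (v, mfderiv I I (fun x : G => x⁻¹) 1 v) := by
    refine (DFunLike.congr_fun (mfderiv_prodMk (f := fun x : G => x) mdifferentiableAt_id
      (mdifferentiableAt_inv 1)) v).trans ?_
    refine congrArg₂ Prod.mk (?_ : @Eq E _ _) rfl
    exact DFunLike.congr_fun (mfderiv_id (I := I) (x := (1 : G))) v
  have hm : ∀ a b : E, @Eq E (mfderiv (I.prod I) I (fun p : G × G => p.1 * p.2) (1, 1) (a, b))
      (a + b) := by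
    intro a b
    refine (mfderiv_prod_eq_add_apply (v := ((a, b) : E × E)) hmul).trans ?_
    have h1 : (fun z : G => z * 1) = id := by ext; simp
    have h2 : (fun z : G => 1 * z) = id := by ext; simp
    have h3 : @Eq (E →L[ℝ] E) (mfderiv I I (fun z : G => z * 1) 1)
        (ContinuousLinearMap.id ℝ E) := by rw [h1]; exact mfderiv_id
    have h4 : @Eq (E →L[ℝ] E) (mfderiv I I (fun z : G => 1 * z) 1)
        (ContinuousLinearMap.id ℝ E) := by rw [h2]; exact mfderiv_id
    exact congrArg₂ (fun A B : E →L[ℝ] E => A a + B b) h3 h4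
  have h5 : @Eq E 0 (@HAdd.hAdd E E E _ v (mfderiv I I (fun x : G => x⁻¹) 1 v)) :=
    h0.trans ((congrArg (mfderiv (I.prod I) I (fun p : G × G => p.1 * p.2) (1, 1)) hp).trans
      (hm _ _))
  exact eq_neg_of_add_eq_zero_right (α := E) h5.symm

theorem mfderiv_inv_comp_mfderiv_inv (g : G) :
    @Eq (E →L[ℝ] E) ((mfderiv I I (fun x : G => x⁻¹) g⁻¹).comp
      (mfderiv I I (fun x : G => x⁻¹) g)) (ContinuousLinearMap.id ℝ E) := by
  have hinv : (fun x : G => x⁻¹) ∘ (fun x : G => x⁻¹) = id := by ext; simp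
  have := mfderiv_comp g (mdifferentiableAt_inv (I := I) g⁻¹) (mdifferentiableAt_inv (I := I) g)
  rw [hinv, mfderiv_id] at this
  exact this.symm

theorem mfderiv_inv_comp_mfderiv_inv' (g : G) :
    @Eq (E →L[ℝ] E) (ContinuousLinearMap.comp (M₂ := E)
      (mfderiv I I (fun x : G => x⁻¹) g : E →L[ℝ] E)
      (mfderiv I I (fun x : G => x⁻¹) g⁻¹ : E →L[ℝ] E)) (ContinuousLinearMap.id ℝ E) := by
  have e : @Eq (E →L[ℝ] E) (mfderiv I I (fun x : G => x⁻¹) g⁻¹⁻¹)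
    (mfderiv I I (fun x : G => x⁻¹) g) := mfderiv_congr_point (inv_inv g)
  have h := mfderiv_inv_comp_mfderiv_inv (I := I) g⁻¹
  exact (congrArg (fun A : E →L[ℝ] E =>
    A.comp (mfderiv I I (fun x : G => x⁻¹) g⁻¹ : E →L[ℝ] E)) e).symm.trans h

theorem mfderiv_inv_inverse (g : G) :
    (mfderiv I I (fun x : G => x⁻¹) g).inverse = mfderiv I I (fun x : G => x⁻¹) g⁻¹ :=
  ContinuousLinearMap.inverse_eq (mfderiv_inv_comp_mfderiv_inv' (I := I) (E := E) g)
    (mfderiv_inv_comp_mfderiv_inv (I := I) (E := E) g)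

theorem isInvertible_mfderiv_inv (g : G) :
    (mfderiv I I (fun x : G => x⁻¹) g).IsInvertible :=
  ContinuousLinearMap.IsInvertible.of_inverse (mfderiv_inv_comp_mfderiv_inv' (I := I) (E := E) g)
    (mfderiv_inv_comp_mfderiv_inv (I := I) (E := E) g)

/-- Differentiate `(g⁻¹ * x)⁻¹ = x⁻¹ * g` at `x = 1` in the direction `-v`; the sign is the
derivative of inversion at `1`. -/
theorem rightInvariantVectorField_eq_mpullback (v : GroupLieAlgebra I G) :
    rightInvariantVectorField I v =
      mpullback I I (fun x : G => x⁻¹) (mulInvariantVectorField (-v)) := by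
  ext g
  have hcomp : (fun x : G => x⁻¹) ∘ (g⁻¹ * ·) = (· * g) ∘ (fun x : G => x⁻¹) := by ext; simp
  have hl := mfderiv_comp_apply_of_eq (g := fun x : G => x⁻¹) (f := (g⁻¹ * ·)) (x := (1 : G))
    (y := g⁻¹) (mdifferentiableAt_inv (I := I) g⁻¹) (mdifferentiableAt_const_mul g⁻¹ 1)
    (mul_one _) (-v)
  have hr := mfderiv_comp_apply_of_eq (g := (· * g)) (f := fun x : G => x⁻¹) (x := (1 : G))
    (y := 1) (mdifferentiableAt_mul_const (I := I) g 1) (mdifferentiableAt_inv 1)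
    inv_one (-v)
  rw [hcomp] at hl
  have h1 : @Eq E (mfderiv I I (· * g) (1 : G) v)
      (mfderiv I I (fun x : G => x⁻¹) g⁻¹ (mulInvariantVectorField (-v) g⁻¹)) := by
    refine Eq.trans ?_ (hr.symm.trans hl)
    refine congrArg (mfderiv I I (· * g) (1 : G)) ?_
    exact ((mfderiv_inv_one (-v)).trans (neg_neg (G := E) v)).symm
  refine h1.trans ?_
  exact (DFunLike.congr_fun (mfderiv_inv_inverse (I := I) g)
    (mulInvariantVectorField (-v) g⁻¹)).symm

theorem mdifferentiable_rightInvariantVectorField [CompleteSpace E] (v : GroupLieAlgebra I G) :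
    MDifferentiable I I.tangent
      (fun g : G => (⟨g, rightInvariantVectorField I v g⟩ : TangentBundle I G)) := by
  have : IsManifold I 2 G := IsManifold.of_le (n := ∞) (WithTop.coe_le_coe.2 le_top)
  rw [rightInvariantVectorField_eq_mpullback]
  exact MDifferentiable.mpullback_vectorField (n := 2)
    ((contMDiff_one_mulInvariantVectorField (-v)).mdifferentiable one_ne_zero)
    ((contMDiff_inv I ∞).of_le (WithTop.coe_le_coe.2 le_top)) isInvertible_mfderiv_inv le_rfl

omit [LieGroup I ∞ G] in
theorem rightInvariantVectorField_one (v : GroupLieAlgebra I G) :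
    rightInvariantVectorField I v (1 : G) = v := by
  have h : (fun x : G => x * 1) = id := by ext; simp
  have h1 : @Eq (E →L[ℝ] E) (mfderiv I I (fun x : G => x * 1) (1 : G))
      (ContinuousLinearMap.id ℝ E) := by
    rw [h]; exact mfderiv_id
  exact DFunLike.congr_fun h1 v

/-- Brackets commute with pullback by inversion. The two signs in `⁅-v, -w⁆` cancel, and the
derivative of inversion at `1` leaves one. -/
theorem rightLieBracket_eq_neg_bracket [CompleteSpace E] (v w : GroupLieAlgebra I G) :
    rightLieBracket I v w = -⁅v, w⁆ := by
  have : IsManifold I (minSmoothness ℝ 3) G := IsManifold.of_le (n := ∞)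
    (by rw [minSmoothness_of_isRCLikeNormedField]; exact WithTop.coe_le_coe.2 le_top)
  have : LieGroup I (minSmoothness ℝ 3) G :=
    LieGroup.of_le (n := ∞)
      (by rw [minSmoothness_of_isRCLikeNormedField]; exact WithTop.coe_le_coe.2 le_top)
  rw [rightLieBracket, rightInvariantVectorField_eq_mpullback,
    rightInvariantVectorField_eq_mpullback, ← mpullback_mlieBracket (n := minSmoothness ℝ 3)
      (mdifferentiableAt_mulInvariantVectorField _) (mdifferentiableAt_mulInvariantVectorField _)
      (contMDiff_inv I _).contMDiffAt (minSmoothness_monotone (by norm_cast))]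
  have hpt : ∀ z : G, z = 1 → @Eq E (mlieBracket I (mulInvariantVectorField (-v))
      (mulInvariantVectorField (-w)) z)
      (⁅(-v : GroupLieAlgebra I G), (-w : GroupLieAlgebra I G)⁆ : GroupLieAlgebra I G) := by
    rintro z rfl; rfl
  have hb : ⁅(-v : GroupLieAlgebra I G), (-w : GroupLieAlgebra I G)⁆ = ⁅v, w⁆ := by rw [neg_lie, lie_neg, neg_neg]
  rw [hb] at hpt
  have h1 := DFunLike.congr_fun (mfderiv_inv_inverse (I := I) (1 : G))
    (mlieBracket I (mulInvariantVectorField (-v)) (mulInvariantVectorField (-w)) (1 : G)⁻¹)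
  refine h1.trans ?_
  refine (congrArg (mfderiv I I (fun x : G => x⁻¹) (1 : G)⁻¹) (hpt _ inv_one)).trans ?_
  refine Eq.trans ?_ (mfderiv_inv_one ⁅v, w⁆)
  exact DFunLike.congr_fun (F := E →L[ℝ] E) (mfderiv_congr_point inv_one) _

end RightInvariant

/-! ### Product rule for vector-valued functions on a manifold -/

section Leibniz

variable {E : Type*} [NormedAddCommGroup E] [NormedSpace ℝ E]
  {H : Type*} [TopologicalSpace H] {I : ModelWithCorners ℝ E H}
  {M : Type*} [TopologicalSpace M] [ChartedSpace H M]
  {F₁ F₂ F₃ : Type*} [NormedAddCommGroup F₁] [NormedSpace ℝ F₁]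
  [NormedAddCommGroup F₂] [NormedSpace ℝ F₂] [NormedAddCommGroup F₃] [NormedSpace ℝ F₃]

theorem mvfderiv_bilinear (B : F₁ →L[ℝ] F₂ →L[ℝ] F₃) {a : M → F₁} {b : M → F₂} {x : M}
    (ha : MDifferentiableAt I 𝓘(ℝ, F₁) a x) (hb : MDifferentiableAt I 𝓘(ℝ, F₂) b x)
    (u : TangentSpace I x) :
    mvfderiv I (fun p => B (a p) (b p)) x u =
      B (a x) (mvfderiv I b x u) + B (mvfderiv I a x u) (b x) := by
  have hab : HasMFDerivAt I 𝓘(ℝ, F₁ × F₂) (fun p => (a p, b p)) x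
      (ContinuousLinearMap.prod (mvfderiv I a x) (mvfderiv I b x)) :=
    ⟨ha.hasMFDerivAt.1.prodMk hb.hasMFDerivAt.1, ha.hasMFDerivAt.2.prodMk hb.hasMFDerivAt.2⟩
  have h := HasMFDerivAt.comp (g := fun q : F₁ × F₂ => B q.1 q.2) x
    (B.isBoundedBilinearMap.hasFDerivAt (a x, b x)).hasMFDerivAt hab
  exact DFunLike.congr_fun h.mfderiv u

theorem mvfderiv_clm_comp (B : F₁ →L[ℝ] F₂) {a : M → F₁} {x : M}
    (ha : MDifferentiableAt I 𝓘(ℝ, F₁) a x) (u : TangentSpace I x) :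
    mvfderiv I (fun p => B (a p)) x u = B (mvfderiv I a x u) := by
  have h := (B.hasFDerivAt (x := a x)).hasMFDerivAt.comp x ha.hasMFDerivAt
  exact DFunLike.congr_fun h.mfderiv u

end Leibniz

/-! ### Differentiating functions along orbits -/

section ActionDeriv

variable {E : Type*} [NormedAddCommGroup E] [NormedSpace ℝ E]
  {H : Type*} [TopologicalSpace H] (I : ModelWithCorners ℝ E H)
  (G : Type*) [TopologicalSpace G] [ChartedSpace H G] [Group G]
  {E' : Type*} [NormedAddCommGroup E'] [NormedSpace ℝ E']
  {H' : Type*} [TopologicalSpace H'] {J : ModelWithCorners ℝ E' H'}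
  {M : Type*} [TopologicalSpace M] [ChartedSpace H' M] [MulAction G M]
  {F : Type*} [NormedAddCommGroup F] [NormedSpace ℝ F]
  {F₁ F₂ F₃ : Type*} [NormedAddCommGroup F₁] [NormedSpace ℝ F₁]
  [NormedAddCommGroup F₂] [NormedSpace ℝ F₂] [NormedAddCommGroup F₃] [NormedSpace ℝ F₃]

/-- The derivative at the identity of `g ↦ z (g • u)`, as a linear map on the Lie algebra. -/
noncomputable def actionDeriv (z : M → F) (u : M) : E →L[ℝ] F :=
  mvfderiv I (fun g : G => z (g • u)) 1

variable {I G}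

theorem contMDiff_smul_const
    (hact : ContMDiff (I.prod J) J ∞ (fun p : G × M => p.1 • p.2)) (u : M) :
    ContMDiff I J ∞ (fun g : G => g • u) :=
  hact.comp (contMDiff_id.prodMk contMDiff_const)

theorem mdifferentiableAt_comp_smul_const
    (hact : ContMDiff (I.prod J) J ∞ (fun p : G × M => p.1 • p.2))
    {z : M → F} (hz : ContMDiff J 𝓘(ℝ, F) ∞ z) (u : M) (g : G) :
    MDifferentiableAt I 𝓘(ℝ, F) (fun g : G => z (g • u)) g :=
  (hz.comp (contMDiff_smul_const hact u)).contMDiffAt.mdifferentiableAt (by simp)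

theorem contMDiff_actionDeriv [IsManifold I ∞ G] [IsManifold J ∞ M]
    (hact : ContMDiff (I.prod J) J ∞ (fun p : G × M => p.1 • p.2))
    {z : M → F} (hz : ContMDiff J 𝓘(ℝ, F) ∞ z) :
    ContMDiff J 𝓘(ℝ, E →L[ℝ] F) ∞ (actionDeriv I G z) := by
  have : IsManifold I 1 G := IsManifold.of_le (n := ∞) (by simp)
  intro u
  have hf : ContMDiffAt (J.prod I) 𝓘(ℝ, F) ∞
      (Function.uncurry fun (p : M) (g : G) => z (g • p)) (u, 1) :=
    (hz.comp (hact.comp (contMDiff_snd.prodMk contMDiff_fst))).contMDiffAt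
  have h := ContMDiffAt.mfderiv (m := ∞) (fun (p : M) (g : G) => z (g • p)) (fun _ => (1 : G)) hf
    contMDiffAt_const (by simp)
  refine h.congr_of_eventuallyEq (Eventually.of_forall fun p => ?_)
  -- Smoothness is known for the derivative in tangent coordinates; as the base point stays at `1`,
  -- the coordinate changes are identities.
  refine Eq.trans ?_ (inTangentCoordinates_eq_mfderiv_comp (I := I) (I' := 𝓘(ℝ, F))
    (f := fun _ : M => (1 : G)) (mem_chart_source H (1 : G))
    (by rw [chartAt_self_eq]; exact mem_univ _)).symm
  have hid : ∀ q r : F, @Eq (F →L[ℝ] F) (mfderiv 𝓘(ℝ, F) 𝓘(ℝ, F) (extChartAt 𝓘(ℝ, F) q) r)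
      (ContinuousLinearMap.id ℝ F) := by
    intro q r
    rw [extChartAt_model_space_eq_id]
    exact mfderiv_id
  ext v
  exact ((DFunLike.congr_fun (hid _ _) _).trans (congrArg (mfderiv I 𝓘(ℝ, F) _ (1 : G))
    (DFunLike.congr_fun (mfderivWithin_range_extChartAt_symm (I := I) (x := (1 : G))) v))).symm

theorem actionDeriv_smul_apply [LieGroup I ∞ G]
    (hact : ContMDiff (I.prod J) J ∞ (fun p : G × M => p.1 • p.2))
    {z : M → F} (hz : ContMDiff J 𝓘(ℝ, F) ∞ z) (h : G) (u : M) (w : GroupLieAlgebra I G) :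
    actionDeriv I G z (h • u) w =
      mvfderiv I (fun g : G => z (g • u)) h (rightInvariantVectorField I w h) := by
  have hc : (fun g : G => z (g • h • u)) = (fun g : G => z (g • u)) ∘ (· * h) := by
    ext g; simp [mul_smul]
  have := mfderiv_comp_apply_of_eq (g := fun g : G => z (g • u)) (f := (· * h)) (x := (1 : G))
    (mdifferentiableAt_comp_smul_const hact hz u h) (mdifferentiableAt_mul_const (I := I) h 1)
    (one_mul h) w
  rw [← hc] at this
  exact this

/-- This says that `λ_*` respects brackets, tested on functions: the commutator formula is applied
on `G` to the orbit function `g ↦ z (g • u)`, so no bracket on `M` is needed. -/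
theorem actionDeriv_rightLieBracket [LieGroup I ∞ G] [CompleteSpace E] [BoundarylessManifold I G]
    (hact : ContMDiff (I.prod J) J ∞ (fun p : G × M => p.1 • p.2))
    {z : M → F} (hz : ContMDiff J 𝓘(ℝ, F) ∞ z) (u : M) (v w : GroupLieAlgebra I G) :
    actionDeriv I G z u (rightLieBracket I v w) =
      actionDeriv I G (fun p => actionDeriv I G z p w) u v -
        actionDeriv I G (fun p => actionDeriv I G z p v) u w := by
  have : IsManifold I 2 G := IsManifold.of_le (n := ∞) (WithTop.coe_le_coe.2 le_top)
  have hf : ContMDiffAt I 𝓘(ℝ, F) 2 (fun g : G => z (g • u)) 1 :=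
    (hz.comp (contMDiff_smul_const hact u)).contMDiffAt.of_le (WithTop.coe_le_coe.2 le_top)
  have h := mvfderiv_mlieBracket hf BoundarylessManifold.isInteriorPoint
    (mdifferentiable_rightInvariantVectorField v 1)
    (mdifferentiable_rightInvariantVectorField w 1)
  simp only [← actionDeriv_smul_apply hact hz, rightInvariantVectorField_one] at h
  exact h

theorem actionDeriv_bilinear (hact : ContMDiff (I.prod J) J ∞ (fun p : G × M => p.1 • p.2))
    (B : F₁ →L[ℝ] F₂ →L[ℝ] F₃) {a : M → F₁} {b : M → F₂}
    (ha : ContMDiff J 𝓘(ℝ, F₁) ∞ a) (hb : ContMDiff J 𝓘(ℝ, F₂) ∞ b) (u : M) (v : E) :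
    actionDeriv I G (fun p => B (a p) (b p)) u v =
      B (a u) (actionDeriv I G b u v) + B (actionDeriv I G a u v) (b u) := by
  have h := mvfderiv_bilinear B (mdifferentiableAt_comp_smul_const (I := I) (G := G) hact ha u 1)
    (mdifferentiableAt_comp_smul_const (I := I) (G := G) hact hb u 1) v
  rw [one_smul] at h
  exact h

theorem mvfderiv_infinitesimalGenerator [LieGroup I ∞ G] [CompleteSpace E] [T2Space G]
    [BoundarylessManifold I G]
    (hact : ContMDiff (I.prod J) J ∞ (fun p : G × M => p.1 • p.2))
    {z : M → F} (hz : ContMDiff J 𝓘(ℝ, F) ∞ z) (u : M) (v : GroupLieAlgebra I G) :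
    mvfderiv J z u (infinitesimalGenerator I J v u) = actionDeriv I G z u v := by
  obtain ⟨γ, h0, hγ⟩ := exists_isMIntegralCurve_mulInvariantVectorField v
  have hexp : (fun t : ℝ => lieExp I (t • v) • u) = (fun g : G => g • u) ∘ γ := by
    ext t; simp [lieExp_smul h0 hγ]
  have hsm : ∀ g : G, MDifferentiableAt I J (fun g : G => g • u) g := fun g =>
    (contMDiff_smul_const hact u).contMDiffAt.mdifferentiableAt (by simp)
  have hcomp : @Eq (ℝ →L[ℝ] E') (mfderiv 𝓘(ℝ, ℝ) J (fun t : ℝ => lieExp I (t • v) • u) 0)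
      ((mfderiv I J (fun g : G => g • u) (γ 0)).comp
        ((1 : ℝ →L[ℝ] ℝ).smulRight (mulInvariantVectorField v (γ 0)))) := by
    rw [hexp]
    exact ((hsm (γ 0)).hasMFDerivAt.comp 0 (hγ 0)).mfderiv
  have hpt : ∀ g : G, g = 1 → @Eq E' (mfderiv I J (fun g : G => g • u) g
      ((1 : ℝ) • mulInvariantVectorField v g)) (mfderiv I J (fun g : G => g • u) 1 v) := by
    rintro g rfl
    exact congrArg (mfderiv I J (fun g : G => g • u) 1)
      ((one_smul ℝ _).trans (mulInvariantVectorField_one v))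
  -- The generator is the derivative of the orbit map at `1`, because `γ` has velocity `v` at time
  -- `0`.
  have hgen : @Eq E' (infinitesimalGenerator I J v u) (mfderiv I J (fun g : G => g • u) 1 v) :=
    (DFunLike.congr_fun hcomp (1 : ℝ)).trans (hpt _ h0)
  have := mfderiv_comp_apply_of_eq (g := z) (f := fun g : G => g • u) (x := (1 : G))
    (hz.contMDiffAt.mdifferentiableAt (by simp)) (hsm 1) (one_smul G u) v
  exact (congrArg (mvfderiv J z u) hgen).trans this.symm

end ActionDeriv

/-! ### The post-Lie identities -/

section PostLie

variable {E : Type*} [NormedAddCommGroup E] [NormedSpace ℝ E]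
  {H : Type*} [TopologicalSpace H] {I : ModelWithCorners ℝ E H}
  {G : Type*} [TopologicalSpace G] [ChartedSpace H G] [Group G]
  {E' : Type*} [NormedAddCommGroup E'] [NormedSpace ℝ E']
  {H' : Type*} [TopologicalSpace H'] {J : ModelWithCorners ℝ E' H'}
  {M : Type*} [TopologicalSpace M] [ChartedSpace H' M] [MulAction G M]
  {F : Type*} [NormedAddCommGroup F] [NormedSpace ℝ F]

theorem actionDeriv_actionDeriv_apply [IsManifold I ∞ G] [IsManifold J ∞ M]
    (hact : ContMDiff (I.prod J) J ∞ (fun p : G × M => p.1 • p.2))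
    {z : M → F} (hz : ContMDiff J 𝓘(ℝ, F) ∞ z) (u : M) (v w : E) :
    actionDeriv I G (fun p => actionDeriv I G z p w) u v =
      actionDeriv I G (actionDeriv I G z) u v w :=
  mvfderiv_clm_comp (ContinuousLinearMap.apply ℝ F w)
    (mdifferentiableAt_comp_smul_const hact (contMDiff_actionDeriv hact hz) u 1) v

theorem actionDeriv_actionDeriv_fun_apply [IsManifold I ∞ G] [IsManifold J ∞ M]
    (hact : ContMDiff (I.prod J) J ∞ (fun p : G × M => p.1 • p.2))
    {z : M → F} (hz : ContMDiff J 𝓘(ℝ, F) ∞ z) {y : M → E} (hy : ContMDiff J 𝓘(ℝ, E) ∞ y)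
    (u : M) (v : E) :
    actionDeriv I G (fun p => actionDeriv I G z p (y p)) u v =
      actionDeriv I G z u (actionDeriv I G y u v) +
        actionDeriv I G (actionDeriv I G z) u v (y u) :=
  actionDeriv_bilinear hact (ContinuousLinearMap.id ℝ (E →L[ℝ] F))
    (contMDiff_actionDeriv hact hz) hy u v

theorem actionDeriv_add (hact : ContMDiff (I.prod J) J ∞ (fun p : G × M => p.1 • p.2))
    {y z : M → F} (hy : ContMDiff J 𝓘(ℝ, F) ∞ y) (hz : ContMDiff J 𝓘(ℝ, F) ∞ z) (u : M) :
    actionDeriv I G (fun p => y p + z p) u = actionDeriv I G y u + actionDeriv I G z u :=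
  mvfderiv_add (mdifferentiableAt_comp_smul_const hact hy u 1)
    (mdifferentiableAt_comp_smul_const hact hz u 1)

theorem actionDeriv_const_smul
    (hact : ContMDiff (I.prod J) J ∞ (fun p : G × M => p.1 • p.2))
    (c : ℝ) {z : M → F} (hz : ContMDiff J 𝓘(ℝ, F) ∞ z) (u : M) (v : E) :
    actionDeriv I G (fun p => c • z p) u v = c • actionDeriv I G z u v :=
  mvfderiv_clm_comp (c • ContinuousLinearMap.id ℝ F)
    (mdifferentiableAt_comp_smul_const hact hz u 1) v

/-- Each difference on the right cancels the term in which `y` (or `x`) is differentiated, leaving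
the second derivatives of `z` on the frozen values `x u`, `y u`. -/
theorem actionDeriv_associator [LieGroup I ∞ G] [CompleteSpace E] [BoundarylessManifold I G]
    [IsManifold J ∞ M]
    (hact : ContMDiff (I.prod J) J ∞ (fun p : G × M => p.1 • p.2))
    {z : M → F} (hz : ContMDiff J 𝓘(ℝ, F) ∞ z) {x y : M → E}
    (hx : ContMDiff J 𝓘(ℝ, E) ∞ x) (hy : ContMDiff J 𝓘(ℝ, E) ∞ y) (u : M) :
    actionDeriv I G z u (rightLieBracket I (G := G) (x u) (y u)) =
      (actionDeriv I G (fun p => actionDeriv I G z p (y p)) u (x u) -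
          actionDeriv I G z u (actionDeriv I G y u (x u))) -
        (actionDeriv I G (fun p => actionDeriv I G z p (x p)) u (y u) -
          actionDeriv I G z u (actionDeriv I G x u (y u))) := by
  refine (actionDeriv_rightLieBracket hact hz u (x u) (y u)).trans ?_
  rw [actionDeriv_actionDeriv_apply hact hz, actionDeriv_actionDeriv_apply hact hz, actionDeriv_actionDeriv_fun_apply hact hz hy,
    actionDeriv_actionDeriv_fun_apply hact hz hx]
  abel

theorem rightLieBracket_jacobi [LieGroup I ∞ G] [CompleteSpace E] (x y z : GroupLieAlgebra I G) :
    rightLieBracket I (rightLieBracket I x y) z + rightLieBracket I (rightLieBracket I y z) x +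
      rightLieBracket I (rightLieBracket I z x) y = 0 := by
  have : LieGroup I (minSmoothness ℝ 3) G :=
    LieGroup.of_le (n := ∞)
      (by rw [minSmoothness_of_isRCLikeNormedField]; exact WithTop.coe_le_coe.2 le_top)
  simp only [rightLieBracket_eq_neg_bracket, neg_lie, neg_neg]
  rw [← lie_skew ⁅x, y⁆ z, ← lie_skew ⁅y, z⁆ x, ← lie_skew ⁅z, x⁆ y, ← neg_add, ← neg_add,
    neg_eq_zero, ← lie_jacobi x y z]
  abel

variable (I G) in
/-- The bracket of the right-invariant vector fields as a bilinear map. -/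
noncomputable def rightLieBracketBilin [LieGroup I ∞ G] [CompleteSpace E] :
    GroupLieAlgebra I G →ₗ[ℝ] GroupLieAlgebra I G →ₗ[ℝ] GroupLieAlgebra I G :=
  have : LieGroup I (minSmoothness ℝ 3) G :=
    LieGroup.of_le (n := ∞)
      (by rw [minSmoothness_of_isRCLikeNormedField]; exact WithTop.coe_le_coe.2 le_top)
  LinearMap.mk₂ ℝ (fun v w => rightLieBracket I v w)
    (by intros; simp only [rightLieBracket_eq_neg_bracket, add_lie, neg_add])
    (by intros; simp only [rightLieBracket_eq_neg_bracket, smul_lie, smul_neg])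
    (by intros; simp only [rightLieBracket_eq_neg_bracket, lie_add, neg_add])
    (by intros; simp only [rightLieBracket_eq_neg_bracket, lie_smul, smul_neg])

-- Finite dimension makes the bilinear bracket continuous, hence smooth, so that pointwise brackets
-- are smooth and the Leibniz rule applies.
variable (I G) in
theorem exists_clm_eq_rightLieBracket [LieGroup I ∞ G] [FiniteDimensional ℝ E] :
    ∃ B : E →L[ℝ] E →L[ℝ] E, ∀ v w : GroupLieAlgebra I G,
      @Eq E (B v w) (rightLieBracket I v w) := by
  have : CompleteSpace E := FiniteDimensional.complete ℝ E
  let b : E →ₗ[ℝ] E →ₗ[ℝ] E := rightLieBracketBilin I G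
  exact ⟨LinearMap.toContinuousLinearMap (LinearMap.toContinuousLinearMap.toLinearMap ∘ₗ b),
    fun v w => rfl⟩

theorem lieDerivAlong_generatedField [LieGroup I ∞ G] [CompleteSpace E] [T2Space G]
    [BoundarylessManifold I G]
    (hact : ContMDiff (I.prod J) J ∞ (fun p : G × M => p.1 • p.2))
    (x : M → GroupLieAlgebra I G) {y : M → GroupLieAlgebra I G}
    (hy : y ∈ smoothLieValued I G J M) (u : M) :
    @Eq E (lieDerivAlong I J (generatedField I J x) y u)
      (actionDeriv I G (F := E) (fun p => tangentModel I (1 : G) (y p)) u (x u)) :=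
  mvfderiv_infinitesimalGenerator hact hy u (x u)

theorem lieDerivAlong_mem_smoothLieValued [LieGroup I ∞ G] [CompleteSpace E] [T2Space G]
    [BoundarylessManifold I G] [IsManifold J ∞ M]
    (hact : ContMDiff (I.prod J) J ∞ (fun p : G × M => p.1 • p.2))
    {x y : M → GroupLieAlgebra I G} (hx : x ∈ smoothLieValued I G J M)
    (hy : y ∈ smoothLieValued I G J M) :
    lieDerivAlong I J (generatedField I J x) y ∈ smoothLieValued I G J M := by
  have h : ContMDiff J 𝓘(ℝ, E) ∞
      (fun p => actionDeriv I G (F := E) (fun p => tangentModel I (1 : G) (y p)) p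
        (tangentModel I (1 : G) (x p))) :=
    (contMDiff_actionDeriv hact hy).clm_apply hx
  exact h.congr fun p => lieDerivAlong_generatedField hact x hy p

omit [MulAction G M] in
theorem rightLieBracket_mem_smoothLieValued [LieGroup I ∞ G] [FiniteDimensional ℝ E]
    {x y : M → GroupLieAlgebra I G} (hx : x ∈ smoothLieValued I G J M)
    (hy : y ∈ smoothLieValued I G J M) :
    (fun u => rightLieBracket I (x u) (y u)) ∈ smoothLieValued I G J M := by
  obtain ⟨B, hB⟩ := exists_clm_eq_rightLieBracket I G
  have h : ContMDiff J 𝓘(ℝ, E) ∞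
      (fun p => B (tangentModel I (1 : G) (x p)) (tangentModel I (1 : G) (y p))) :=
    (B.contMDiff.comp hx).clm_apply hy
  exact h.congr fun p => (hB _ _).symm

end PostLie

theorem mainTheorem6
    {E : Type*} [NormedAddCommGroup E] [NormedSpace ℝ E] [FiniteDimensional ℝ E]
    {H : Type*} [TopologicalSpace H] (I : ModelWithCorners ℝ E H)
    {G : Type*} [TopologicalSpace G] [ChartedSpace H G] [Group G] [LieGroup I ∞ G]
    [T2Space G] [BoundarylessManifold I G]
    {E' : Type*} [NormedAddCommGroup E'] [NormedSpace ℝ E'] [FiniteDimensional ℝ E']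
    {H' : Type*} [TopologicalSpace H'] (J : ModelWithCorners ℝ E' H')
    {M : Type*} [TopologicalSpace M] [ChartedSpace H' M] [IsManifold J ∞ M]
    [BoundarylessManifold J M]
    [MulAction G M] (hact : ContMDiff (I.prod J) J ∞ (fun p : G × M => p.1 • p.2)) :
    ∃ brR brL tri : smoothLieValued I G J M →ₗ[ℝ]
        smoothLieValued I G J M →ₗ[ℝ] smoothLieValued I G J M,
      (∀ x y u, (brR x y).1 u = rightLieBracket I (x.1 u) (y.1 u)) ∧
      (∀ x y u, (brL x y).1 u = -⁅x.1 u, y.1 u⁆) ∧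
      (∀ x y, (tri x y).1 = lieDerivAlong I J (generatedField I J x.1) y.1) ∧
      IsPostLieAlgebra brR tri ∧ IsPostLieAlgebra brL tri := by
  have : CompleteSpace E := FiniteDimensional.complete ℝ E
  obtain ⟨B, hB⟩ := exists_clm_eq_rightLieBracket I G
  let Ω := smoothLieValued I G J M
  let br : Ω →ₗ[ℝ] Ω →ₗ[ℝ] Ω := LinearMap.mk₂ ℝ
    (fun x y => ⟨fun u => rightLieBracket I (x.1 u) (y.1 u),
      rightLieBracket_mem_smoothLieValued x.2 y.2⟩)
    (fun x x' y => Subtype.ext <| funext fun u =>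
      (rightLieBracketBilin I G).map_add₂ (x.1 u) (x'.1 u) (y.1 u))
    (fun c x y => Subtype.ext <| funext fun u =>
      (rightLieBracketBilin I G).map_smul₂ c (x.1 u) (y.1 u))
    (fun x y y' => Subtype.ext <| funext fun u =>
      (rightLieBracketBilin I G (x.1 u)).map_add (y.1 u) (y'.1 u))
    (fun c x y => Subtype.ext <| funext fun u =>
      (rightLieBracketBilin I G (x.1 u)).map_smul c (y.1 u))
  -- Elements of `Ω` read as `E`-valued maps, the form in which the calculus lemmas apply.
  let Y : Ω → M → E := fun y p => tangentModel I (1 : G) (y.1 p)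
  have hY : ∀ y : Ω, ContMDiff J 𝓘(ℝ, E) ∞ (Y y) := fun y => y.2
  have hD : ∀ (x y : Ω) u, @Eq E (lieDerivAlong I J (generatedField I J x.1) y.1 u)
      (actionDeriv I G (Y y) u (Y x u)) :=
    fun x y u => lieDerivAlong_generatedField hact x.1 y.2 u
  let tri : Ω →ₗ[ℝ] Ω →ₗ[ℝ] Ω := LinearMap.mk₂ ℝ
    (fun x y => ⟨lieDerivAlong I J (generatedField I J x.1) y.1,
      lieDerivAlong_mem_smoothLieValued hact x.2 y.2⟩)
    (fun x x' y => Subtype.ext <| funext fun u =>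
      (hD (x + x') y u).trans (((actionDeriv I G (Y y) u).map_add (Y x u) (Y x' u)).trans
        (congrArg₂ (α := E) (β := E) (· + ·) (hD x y u) (hD x' y u)).symm))
    (fun c x y => Subtype.ext <| funext fun u =>
      (hD (c • x) y u).trans (((actionDeriv I G (Y y) u).map_smul c (Y x u)).trans
        (congrArg (α := E) (c • ·) (hD x y u)).symm))
    (fun x y y' => Subtype.ext <| funext fun u =>
      (hD x (y + y') u).trans ((DFunLike.congr_fun
        (actionDeriv_add (I := I) (G := G) hact (hY y) (hY y') u) (Y x u)).trans
          (congrArg₂ (α := E) (β := E) (· + ·) (hD x y u) (hD x y' u)).symm))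
    (fun c x y => Subtype.ext <| funext fun u =>
      (hD x (c • y) u).trans
        ((actionDeriv_const_smul (I := I) (G := G) hact c (hY y) u (Y x u)).trans
          (congrArg (α := E) (c • ·) (hD x y u)).symm))
  have hbr : ∀ (x y : Ω) u, (br x y).1 u = rightLieBracket I (x.1 u) (y.1 u) :=
    fun _ _ _ => rfl
  have hpost : IsPostLieAlgebra br tri := by
    refine ⟨?_, ?_, ?_, ?_⟩
    · intro x
      refine Subtype.ext (funext fun u => ?_)
      exact congrFun (VectorField.mlieBracket_self (I := I)) (1 : G)
    · intro x y z
      exact Subtype.ext (funext fun u => rightLieBracket_jacobi (x.1 u) (y.1 u) (z.1 u))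
    · intro x y z
      refine Subtype.ext (funext fun u => ?_)
      have h := actionDeriv_bilinear (I := I) hact B (hY y) (hY z) u (Y x u)
      have hyz : Y (br y z) = fun p => B (Y y p) (Y z p) :=
        funext fun p => (hB (y.1 p) (z.1 p)).symm
      rw [← hyz, ← hD x y u, ← hD x z u, ← hD x (br y z) u, add_comm] at h
      exact h.trans (congrArg₂ (α := E) (β := E) (· + ·) (hB _ _) (hB _ _))
    · intro x y z
      refine Subtype.ext (funext fun u => ?_)
      have h := actionDeriv_associator (I := I) hact (hY z) (hY x) (hY y) u
      -- These two identities turn every nested derivative in `h` into an iterated product `▷`.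
      have hyz : ∀ y : Ω, Y (tri y z) = fun p => actionDeriv I G (Y z) p (Y y p) :=
        fun y => funext fun p => hD y z p
      have hxy : ∀ x y : Ω, actionDeriv I G (Y y) u (Y x u) = Y (tri x y) u :=
        fun x y => (hD x y u).symm
      rw [← hyz, ← hyz, hxy, hxy, hxy, hxy, hxy, hxy] at h
      exact (hD (br x y) z u).trans h
  -- One map serves as both brackets, since the right-invariant bracket is minus the left-invariant
  -- one.
  refine ⟨br, br, tri, hbr, fun x y u => ?_, fun _ _ => rfl, hpost, hpost⟩
  rw [hbr, rightLieBracket_eq_neg_bracket]
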